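/- There is a universal constant $C>0$ (one may take $C=92$) with the following property. Let $G=(V,E)$ be any finite, simple, connected, regular graph. Let $\omega$ be a uniform spanning tree of $G$ (a uniformly random element of the set of spanning trees of $G$), let $X$ be a uniformly random vertex of $G$, independent of $\omega$, and let $\deg(X;\omega)$ be the degree of $X$ in $\omega$. Then $$\mathbb{E}\big[\deg(X;\omega)^2\big]\le C .$$ -/

import Mathlib

open MeasureTheory ProbabilityTheory

universe u v

namespace SpanningTreeDegree

/-- The (finite) set of all simple graphs on `V` carries the discrete σ-algebra. -/
instance instMeasurableSpaceSimpleGraph (V : Type u) : MeasurableSpace (SimpleGraph V) := ⊤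

instance instDiscreteMeasurableSpaceSimpleGraph (V : Type u) :
    DiscreteMeasurableSpace (SimpleGraph V) := ⟨fun _ => trivial⟩

/-- The spanning trees of `G`: subgraphs of `G` on the full vertex set that are trees. -/
def spanningTrees {V : Type u} (G : SimpleGraph V) : Set (SimpleGraph V) :=
  {T | T ≤ G ∧ T.IsTree}

/-- The uniform spanning tree measure: the uniform probability measure on the set of spanning
trees of `G`. -/
noncomputable def ustMeasure {V : Type u} (G : SimpleGraph V) : Measure (SimpleGraph V) :=
  uniformOn (spanningTrees G)

open Classical in
/-- The degree of the vertex `x` in the graph `T`. -/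
noncomputable def deg {V : Type u} [Fintype V] (x : V) (T : SimpleGraph V) : ℕ :=
  T.degree x

end SpanningTreeDegree

/-! Fix `v`, let `A` be the Laplacian grounded at `v`, `D` the indicator of its neighbors, `Z` the
number of spanning trees. The matrix-tree theorem with weight `1 + s` at `v` gives `∑ (1 + s) ^ deg
= det (A + s D) = Z det (1 + s D A⁻¹ D)`. The last matrix is symmetric, so this polynomial splits
over the reals, which forces variance ≤ mean: `E deg² ≤ ρ² + ρ`, where the mean `ρ v` is the sum of
the resistances `R` of the edges at `v`. Foster's theorem gives `∑ ρ = 2n - 2`. In a `d`-regular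
graph, `c ≤ R ≤ 1` on edges with `c = 2 / (d + 1)`. This is nearly tight on average, so
Cauchy–Schwarz and `(1 - R)(R - c) ≥ 0` give `∑ ρ² ≤ 6n`, whence the bound `6 + 2 = 8`. -/

namespace SpanningTreeDegree

/-! ### Spanning trees as parent functions -/

section Rooted

open Classical Finset

variable {V : Type*}

/-- A parent function towards the root `v`: every orbit of `f` ends in the fixed point `v`. -/
def Rooted (v : V) (f : V → V) : Prop :=
  f v = v ∧ ∀ u, ∃ k, f^[k] u = v

/-- The graph joining every vertex to its image under `f`. -/
def parentGraph (f : V → V) : SimpleGraph V :=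
  SimpleGraph.fromRel fun a b => f a = b

lemma parentGraph_adj {f : V → V} {a b : V} :
    (parentGraph f).Adj a b ↔ a ≠ b ∧ (f a = b ∨ f b = a) := by
  simp [parentGraph]

lemma iterate_eq_of_le {v : V} {f : V → V} (hv : f v = v) {u : V} {k l : ℕ} (hkl : k ≤ l)
    (hk : f^[k] u = v) : f^[l] u = v := by
  obtain ⟨m, rfl⟩ := Nat.exists_eq_add_of_le' hkl
  rw [Function.iterate_add_apply, hk, Function.iterate_fixed hv]

lemma Rooted.ne {v : V} {f : V → V} (hf : Rooted v f) {u : V} (hu : u ≠ v) : f u ≠ u := by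
  intro h
  obtain ⟨k, hk⟩ := hf.2 u
  exact hu (by rwa [Function.iterate_fixed h] at hk)

lemma Rooted.apply_apply_ne {v : V} {f : V → V} (hf : Rooted v f) {u : V} (hu : u ≠ v) :
    f (f u) ≠ u := by
  intro h
  obtain ⟨k, hk⟩ := hf.2 u
  have h2 : f^[2 * k] u = u := by
    rw [Function.iterate_mul]
    exact Function.iterate_fixed h k
  exact hu (h2.symm.trans (iterate_eq_of_le hf.1 (by omega) hk))

lemma Rooted.parentGraph_connected {v : V} {f : V → V} (hf : Rooted v f) :
    (parentGraph f).Connected := by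
  have step : ∀ u, (parentGraph f).Reachable u (f u) := by
    intro u
    by_cases h : u = f u
    · rw [← h]
    · exact SimpleGraph.Adj.reachable (parentGraph_adj.2 ⟨h, Or.inl rfl⟩)
  have iter : ∀ k u, (parentGraph f).Reachable u (f^[k] u) := by
    intro k
    induction k with
    | zero => exact fun u => SimpleGraph.Reachable.refl u
    | succ k ih => exact fun u => (step u).trans (ih (f u))
  have hroot : ∀ u, (parentGraph f).Reachable u v := by
    intro u
    obtain ⟨k, hk⟩ := hf.2 u
    exact hk ▸ iter k u
  have : Nonempty V := ⟨v⟩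
  exact ⟨fun a b => (hroot a).trans (hroot b).symm⟩

/-- A disagreement at `u` propagates along the `g`-orbit of `u` up to the root, where both functions
agree. -/
lemma Rooted.eq_of_parentGraph_eq {v : V} {f g : V → V} (hf : Rooted v f) (hg : Rooted v g)
    (h : parentGraph f = parentGraph g) : f = g := by
  by_contra hne
  obtain ⟨u, hu⟩ := Function.ne_iff.1 hne
  have key : ∀ u, f u ≠ g u → f (g u) ≠ g (g u) := by
    intro u hu
    have huv : u ≠ v := by
      rintro rfl
      exact hu (hf.1.trans hg.1.symm)
    have hadj : (parentGraph f).Adj u (g u) := by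
      rw [h]
      exact parentGraph_adj.2 ⟨(hg.ne huv).symm, Or.inl rfl⟩
    -- The edge from `u` to `g u` must come from `f (g u) = u`, whereas `g` never reverses an edge.
    rw [(parentGraph_adj.1 hadj).2.resolve_left hu]
    exact (hg.apply_apply_ne huv).symm
  have iter : ∀ k, f (g^[k] u) ≠ g (g^[k] u) := by
    intro k
    induction k with
    | zero => exact hu
    | succ k ih =>
      rw [Function.iterate_succ_apply']
      exact key _ ih
  obtain ⟨k, hk⟩ := hg.2 u
  exact iter k (by rw [hk, hf.1, hg.1])

lemma mem_spanningTrees {G T : SimpleGraph V} : T ∈ spanningTrees G ↔ T ≤ G ∧ T.IsTree :=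
  Iff.rfl

/-- The parent of `u` is the next vertex on a geodesic to `v`. The resulting graph is connected
inside `T`, and a tree is minimal connected. -/
lemma exists_rooted_of_isTree {T : SimpleGraph V} (hT : T.IsTree) (v : V) :
    ∃ f, Rooted v f ∧ parentGraph f = T := by
  have hex : ∀ u, ∃ w, if u = v then w = v else T.Adj u w ∧ T.dist w v + 1 = T.dist u v := by
    intro u
    split_ifs with huv
    · exact ⟨v, rfl⟩
    obtain ⟨p, hp⟩ := hT.1.exists_walk_length_eq_dist u v
    cases p with
    | nil => exact absurd rfl huv
    | @cons _ w _ hadj q =>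
      refine ⟨w, hadj, le_antisymm ?_ ?_⟩
      · rw [← hp, SimpleGraph.Walk.length_cons]
        exact Nat.succ_le_succ (SimpleGraph.dist_le q)
      · obtain ⟨r, hr⟩ := hT.1.exists_walk_length_eq_dist w v
        rw [← hr, ← SimpleGraph.Walk.length_cons (h := hadj)]
        exact SimpleGraph.dist_le _
  choose f hf using hex
  have hv : f v = v := by simpa using hf v
  have hne : ∀ u, u ≠ v → T.Adj u (f u) ∧ T.dist (f u) v + 1 = T.dist u v := by
    intro u hu
    simpa [hu] using hf u
  have hroot : Rooted v f := by
    refine ⟨hv, fun u => ?_⟩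
    induction hn : T.dist u v generalizing u with
    | zero => exact ⟨0, hT.1.dist_eq_zero_iff.1 hn⟩
    | succ n ih =>
      have huv : u ≠ v := by
        rintro rfl
        simp at hn
      obtain ⟨k, hk⟩ := ih (f u) (by have := (hne u huv).2; omega)
      exact ⟨k + 1, hk⟩
  have hle : parentGraph f ≤ T := by
    intro a b hab
    obtain ⟨hab, h⟩ := parentGraph_adj.1 hab
    rcases h with rfl | rfl
    · refine (hne a ?_).1
      rintro rfl
      exact hab hv.symm
    · refine (hne b ?_).1.symm
      rintro rfl
      exact hab hv
  exact ⟨f, hroot, hle.antisymm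
    ((SimpleGraph.isTree_iff_minimal_connected.1 hT).2 hroot.parentGraph_connected hle)⟩

variable [Fintype V]

lemma parentGraph_edgeFinset_subset {v : V} {f : V → V} (hv : f v = v) :
    (parentGraph f).edgeFinset ⊆ (univ.erase v).image fun u => s(u, f u) := by
  intro e
  induction e with
  | _ a b =>
    simp only [SimpleGraph.mem_edgeFinset, SimpleGraph.mem_edgeSet, parentGraph_adj, mem_image,
      mem_erase, mem_univ, and_true]
    rintro ⟨hab, h | h⟩
    · refine ⟨a, ?_, by rw [h]⟩
      rintro rfl
      exact hab (hv.symm.trans h)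
    · refine ⟨b, ?_, by rw [h, Sym2.eq_swap]⟩
      rintro rfl
      exact hab (h.symm.trans hv)

lemma Rooted.parentGraph_isTree {v : V} {f : V → V} (hf : Rooted v f) :
    (parentGraph f).IsTree := by
  rw [SimpleGraph.isTree_iff_connected_and_card]
  refine ⟨hf.parentGraph_connected, le_antisymm ?_
    hf.parentGraph_connected.card_vert_le_card_edgeSet_add_one⟩
  have h := (card_le_card (parentGraph_edgeFinset_subset hf.1)).trans card_image_le
  rw [card_erase_of_mem (mem_univ v), card_univ] at h
  have : 0 < Fintype.card V := Fintype.card_pos_iff.2 ⟨v⟩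
  rw [Nat.card_eq_fintype_card, Nat.card_eq_fintype_card, ← SimpleGraph.edgeFinset_card]
  omega

lemma Rooted.deg_parentGraph {v : V} {f : V → V} (hf : Rooted v f) :
    deg v (parentGraph f) = #{u | u ≠ v ∧ f u = v} := by
  rw [deg, ← SimpleGraph.card_neighborFinset_eq_degree]
  congr 1
  ext u
  simp only [SimpleGraph.mem_neighborFinset, parentGraph_adj, mem_filter, mem_univ, true_and,
    hf.1]
  constructor
  · rintro ⟨h, h' | h'⟩
    · exact absurd h' h
    · exact ⟨h.symm, h'⟩
  · rintro ⟨h, h'⟩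
    exact ⟨h.symm, Or.inr h'⟩

/-- Assignments to each vertex other than `v` of one of its neighbors. -/
noncomputable def parentChoices (G : SimpleGraph V) (v : V) : Finset (V → V) :=
  Fintype.piFinset fun u => if u = v then {v} else G.neighborFinset u

lemma mem_parentChoices {G : SimpleGraph V} {v : V} {f : V → V} :
    f ∈ parentChoices G v ↔ f v = v ∧ ∀ u, u ≠ v → G.Adj u (f u) := by
  simp only [parentChoices, Fintype.mem_piFinset]
  constructor
  · intro h
    refine ⟨by simpa using h v, fun u hu => by simpa [hu] using h u⟩
  · rintro ⟨h, h'⟩ u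
    by_cases hu : u = v
    · simp [hu, h]
    · simpa [hu] using h' u hu

lemma sum_rooted_eq_sum_spanningTrees {M : Type*} [AddCommMonoid M] (G : SimpleGraph V) (v : V)
    (F : ℕ → M) :
    ∑ f ∈ parentChoices G v with Rooted v f, F #{u | u ≠ v ∧ f u = v} =
      ∑ T ∈ (spanningTrees G).toFinset, F (deg v T) := by
  refine sum_bij (fun f _ => parentGraph f) ?_ ?_ ?_ ?_
  · intro f hf
    rw [mem_filter, mem_parentChoices] at hf
    obtain ⟨⟨hv, hadj⟩, hroot⟩ := hf
    rw [Set.mem_toFinset, mem_spanningTrees]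
    refine ⟨?_, hroot.parentGraph_isTree⟩
    intro a b hab
    obtain ⟨hab, h⟩ := parentGraph_adj.1 hab
    rcases h with rfl | rfl
    · refine hadj a ?_
      rintro rfl
      exact hab hv.symm
    · refine (hadj b ?_).symm
      rintro rfl
      exact hab hv
  · intro f hf g hg h
    exact (mem_filter.1 hf).2.eq_of_parentGraph_eq (mem_filter.1 hg).2 h
  · intro T hT
    rw [Set.mem_toFinset, mem_spanningTrees] at hT
    obtain ⟨f, hf, rfl⟩ := exists_rooted_of_isTree hT.2 v
    refine ⟨f, ?_, rfl⟩
    rw [mem_filter, mem_parentChoices]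
    exact ⟨⟨hf.1, fun u hu => hT.1 (parentGraph_adj.2 ⟨(hf.ne hu).symm, Or.inl rfl⟩)⟩, hf⟩
  · intro f hf
    rw [(mem_filter.1 hf).2.deg_parentGraph]

end Rooted

/-! ### Matrix-tree theorem -/

section Determinant

open Classical Finset Matrix

variable {V : Type*} [Fintype V]

/-- The matrix of the parent function `f`, with the column of the root `v` erased. -/
noncomputable def parentMatrix (v : V) (f : V → V) : Matrix V V ℝ :=
  of fun u w => if f u = w ∧ w ≠ v then 1 else 0

lemma parentMatrix_mulVec (v : V) (f : V → V) (x : V → ℝ) (u : V) :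
    (parentMatrix v f *ᵥ x) u = if f u = v then 0 else x (f u) := by
  simp only [parentMatrix, mulVec, dotProduct, of_apply, ite_mul, one_mul, zero_mul]
  split_ifs with h
  · refine sum_eq_zero fun w _ => if_neg ?_
    rintro ⟨rfl, h'⟩
    exact h' h
  · rw [sum_eq_single (f u)]
    · simp [h]
    · intro w _ hw
      exact if_neg fun h => hw h.1.symm
    · simp

lemma parentMatrix_pow_mulVec {v : V} {f : V → V} (hv : f v = v) (x : V → ℝ) (k : ℕ) (u : V) :
    (parentMatrix v f ^ (k + 1) *ᵥ x) u = if f^[k + 1] u = v then 0 else x (f^[k + 1] u) := by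
  induction k generalizing u with
  | zero => simpa using parentMatrix_mulVec v f x u
  | succ k ih =>
    rw [pow_succ', ← mulVec_mulVec, parentMatrix_mulVec, ih,
      Function.iterate_succ_apply f (k + 1) u]
    by_cases h : f u = v
    · rw [if_pos h, h, if_pos (Function.iterate_fixed hv _)]
    · rw [if_neg h]

lemma Rooted.isNilpotent_parentMatrix {v : V} {f : V → V} (hf : Rooted v f) :
    IsNilpotent (parentMatrix v f) := by
  choose k hk using hf.2
  refine ⟨univ.sup k + 1, ?_⟩
  apply ext_of_mulVec_single
  intro w
  ext u
  rw [parentMatrix_pow_mulVec hf.1, if_pos, zero_mulVec, Pi.zero_apply]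
  exact iterate_eq_of_le hf.1 ((le_sup (mem_univ u)).trans (Nat.le_succ _)) (hk u)

lemma det_one_sub_of_isNilpotent {M : Matrix V V ℝ} (hM : IsNilpotent M) : (1 - M).det = 1 := by
  have h := (isNilpotent_charpoly_sub_pow_of_isNilpotent hM).eq_zero
  have h1 := eval_charpoly M 1
  rw [sub_eq_zero.1 h] at h1
  simpa using h1.symm

/-- If `f` is rooted, the matrix is nilpotent; otherwise the indicator of the vertices that never
reach `v` lies in the kernel of `1 - parentMatrix v f`. -/
lemma det_one_sub_parentMatrix {v : V} {f : V → V} (hv : f v = v) :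
    (1 - parentMatrix v f).det = if Rooted v f then 1 else 0 := by
  split_ifs with hf
  · exact det_one_sub_of_isNilpotent hf.isNilpotent_parentMatrix
  · rw [← exists_mulVec_eq_zero_iff]
    have hex : ∃ u, ¬∃ k, f^[k] u = v := by
      by_contra! h
      exact hf ⟨hv, h⟩
    obtain ⟨u, hu⟩ := hex
    refine ⟨fun w => if ∃ k, f^[k] w = v then 0 else 1, ?_, ?_⟩
    · intro h
      have := congrFun h u
      simp [hu] at this
    · ext w
      rw [sub_mulVec, one_mulVec, Pi.sub_apply, parentMatrix_mulVec, Pi.zero_apply, sub_eq_zero]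
      have hiff : (∃ k, f^[k] w = v) ↔ ∃ k, f^[k] (f w) = v := by
        constructor
        · rintro ⟨k, hk⟩
          exact ⟨k, (iterate_eq_of_le hv (Nat.le_succ k) hk :)⟩
        · rintro ⟨k, hk⟩
          exact ⟨k + 1, hk⟩
      by_cases h : f w = v
      · rw [if_pos h, if_pos ⟨1, h⟩]
      · rw [if_neg h, if_congr hiff rfl rfl]

/-- The Laplacian of `G` grounded at `v`: the row and the column of `v` are those of the
identity matrix. -/
noncomputable def groundedLap (G : SimpleGraph V) (v : V) : Matrix V V ℝ :=
  of fun i j => if i = v ∨ j = v then (if i = j then 1 else 0) else G.lapMatrix ℝ i j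

/-- The diagonal indicator matrix of the neighborhood of `v`. -/
noncomputable def neighborDiag (G : SimpleGraph V) (v : V) : Matrix V V ℝ :=
  diagonal fun u => if G.Adj v u then 1 else 0

lemma lapMatrix_apply (G : SimpleGraph V) (i j : V) :
    G.lapMatrix ℝ i j = (if i = j then (G.degree i : ℝ) else 0) - if G.Adj i j then 1 else 0 := by
  simp [SimpleGraph.lapMatrix, SimpleGraph.degMatrix, SimpleGraph.adjMatrix_apply,
    diagonal_apply]

/-- Each row is a sum over the possible parents of `i`, so multilinearity expands the determinant
over parent functions. -/
lemma groundedLap_add_row (G : SimpleGraph V) (v : V) (s : ℝ) (i : V) :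
    (groundedLap G v + s • neighborDiag G v) i =
      ∑ w ∈ (if i = v then {v} else G.neighborFinset i),
        (if i ≠ v ∧ w = v then 1 + s else 1 : ℝ) •
          ((Pi.single i 1 : V → ℝ) - if w = v then 0 else Pi.single w 1) := by
  ext j
  by_cases hi : i = v
  · subst hi
    by_cases hj : i = j
    · subst hj
      simp [groundedLap, neighborDiag]
    · simp [groundedLap, neighborDiag, hj, Ne.symm hj]
  · have hsplit : ∀ w, ((if i ≠ v ∧ w = v then 1 + s else 1 : ℝ) •
        ((Pi.single i 1 : V → ℝ) - if w = v then 0 else Pi.single w 1) : V → ℝ) j =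
        (if i = j then 1 + (if w = v then s else 0) else 0) -
          if w = j then (if j = v then 0 else 1) else 0 := by
      intro w
      by_cases hw : w = v <;> by_cases hij : i = j <;> by_cases hwj : w = j <;>
        simp_all [Pi.single_apply, eq_comm]
    rw [if_neg hi, Finset.sum_apply, sum_congr rfl fun w _ => hsplit w, sum_sub_distrib]
    simp only [sum_ite_eq', SimpleGraph.mem_neighborFinset]
    by_cases hij : i = j
    · subst hij
      simp [groundedLap, neighborDiag, hi, lapMatrix_apply, sum_add_distrib, G.adj_comm v i]
    · by_cases hj : j = v <;>
      simp [groundedLap, neighborDiag, hi, hij, lapMatrix_apply, hj]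

/-- The matrix-tree theorem, with the edges at `v` given weight `1 + s`. -/
theorem det_groundedLap_add (G : SimpleGraph V) (v : V) (s : ℝ) :
    (groundedLap G v + s • neighborDiag G v).det =
      ∑ T ∈ (spanningTrees G).toFinset, (1 + s) ^ deg v T := by
  rw [← sum_rooted_eq_sum_spanningTrees G v fun k => (1 + s) ^ k, sum_filter]
  have hA : groundedLap G v + s • neighborDiag G v = fun i =>
      ∑ w ∈ (if i = v then {v} else G.neighborFinset i),
        (if i ≠ v ∧ w = v then 1 + s else 1 : ℝ) •
          ((Pi.single i 1 : V → ℝ) - if w = v then 0 else Pi.single w 1) :=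
    funext (groundedLap_add_row G v s)
  change detRowAlternating.toMultilinearMap _ = _
  rw [hA, MultilinearMap.map_sum_finset]
  refine sum_congr rfl fun f hf => ?_
  rw [MultilinearMap.map_smul_univ]
  have hv : f v = v := (mem_parentChoices.1 hf).1
  have hN : (of fun i => (Pi.single i 1 : V → ℝ) - if f i = v then 0 else Pi.single (f i) 1) =
      1 - parentMatrix v f := by
    ext i j
    by_cases h : f i = v
    · simp [parentMatrix, Matrix.sub_apply, h, Pi.single_apply, one_apply, eq_comm]
    · by_cases hj : j = f i <;>
      simp [parentMatrix, Matrix.sub_apply, Ne.symm h, Pi.single_apply, one_apply, hj, eq_comm]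
  have hdet := det_one_sub_parentMatrix hv
  rw [← hN] at hdet
  refine Eq.trans (congrArg (HSMul.hSMul _) hdet) ?_
  rw [prod_ite, prod_const_one, prod_const, mul_one, smul_eq_mul,
    mul_ite, mul_one, mul_zero]

end Determinant

/-! ### Moments from a real-rooted generating function -/

section Moments

open Finset Matrix Polynomial

lemma coeff_prod_one_add {ι : Type*} (s : Finset ι) (a : ι → ℝ) :
    (∏ i ∈ s, (1 + C (a i) * X)).coeff 0 = 1 ∧
    (∏ i ∈ s, (1 + C (a i) * X)).coeff 1 = ∑ i ∈ s, a i ∧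
    2 * (∏ i ∈ s, (1 + C (a i) * X)).coeff 2 = (∑ i ∈ s, a i) ^ 2 - ∑ i ∈ s, a i ^ 2 := by
  classical
  induction s using Finset.induction_on with
  | empty => simp [coeff_one]
  | insert i s hi ih =>
    obtain ⟨h0, h1, h2⟩ := ih
    have hc : ∀ n, (∏ j ∈ insert i s, (1 + C (a j) * X)).coeff (n + 1) =
        (∏ j ∈ s, (1 + C (a j) * X)).coeff (n + 1) + a i * (∏ j ∈ s, (1 + C (a j) * X)).coeff n := by
      intro n
      rw [prod_insert hi, add_mul, one_mul, coeff_add, mul_assoc, coeff_C_mul, coeff_X_mul]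
    refine ⟨?_, ?_, ?_⟩
    · rw [prod_insert hi, mul_coeff_zero, h0]
      simp
    · rw [hc, h0, h1, sum_insert hi]
      ring
    · rw [hc, mul_add, h2, h1, sum_insert hi, sum_insert hi]
      ring

lemma coeff_one_add_X_pow_two (k : ℕ) :
    2 * ((1 + X : ℝ[X]) ^ k).coeff 2 = (k : ℝ) ^ 2 - k := by
  have h := Nat.cast_choose_two ℝ k
  rw [coeff_one_add_X_pow, h]
  ring

/-- If the generating function of `D` factors over the reals, then the variance of `D` is at most
its mean. -/
lemma moments_of_sum_pow_eq_prod {ι κ : Type*} (S : Finset κ) (D : κ → ℕ) (t : Finset ι)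
    (a : ι → ℝ) {Z : ℝ} (hZ : 0 ≤ Z)
    (h : ∀ s : ℝ, ∑ T ∈ S, (1 + s) ^ D T = Z * ∏ i ∈ t, (1 + s * a i)) :
    ∑ T ∈ S, (D T : ℝ) = Z * ∑ i ∈ t, a i ∧
      ∑ T ∈ S, (D T : ℝ) ^ 2 ≤ Z * (∑ i ∈ t, a i) ^ 2 + Z * ∑ i ∈ t, a i := by
  have hp : ∑ T ∈ S, (1 + X : ℝ[X]) ^ D T = C Z * ∏ i ∈ t, (1 + C (a i) * X) := by
    refine Polynomial.funext fun s => ?_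
    simp only [eval_finsetSum, eval_pow, eval_add, eval_one, eval_X, eval_mul, eval_C, eval_prod, h]
    simp only [mul_comm s]
  obtain ⟨-, h1, h2⟩ := coeff_prod_one_add t a
  have e1 := congrArg (fun p => p.coeff 1) hp
  have e2 := congrArg (fun p => 2 * p.coeff 2) hp
  simp only [finsetSum_coeff, coeff_C_mul, coeff_one_add_X_pow, Nat.choose_one_right, h1] at e1
  simp only [finsetSum_coeff, coeff_C_mul, mul_sum, coeff_one_add_X_pow_two, sum_sub_distrib,
    mul_left_comm 2 Z, h2] at e2
  refine ⟨e1, ?_⟩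
  -- Coefficient 2 encodes the second factorial moment `Z * ((∑ a)² - ∑ a²)`; only the sign of the
  -- last term is needed, not that of the `a i`.
  have : 0 ≤ Z * ∑ i ∈ t, a i ^ 2 := mul_nonneg hZ (sum_nonneg fun i _ => sq_nonneg _)
  linarith

lemma det_one_add_smul_of_isHermitian {n : Type*} [Fintype n] [DecidableEq n] {H : Matrix n n ℝ}
    (hH : H.IsHermitian) (s : ℝ) : (1 + s • H).det = ∏ i, (1 + s * hH.eigenvalues i) := by
  rcases eq_or_ne s 0 with rfl | hs
  · simp
  -- Rewritten to evaluate the characteristic polynomial at `-s⁻¹`.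
  have h : 1 + s • H = (-s) • (scalar n (-s⁻¹) - H) := by
    rw [smul_sub, scalar_apply, ← smul_one_eq_diagonal, smul_smul, neg_mul_neg,
      mul_inv_cancel₀ hs, one_smul, neg_smul, sub_neg_eq_add]
  rw [h, det_smul, ← eval_charpoly, hH.charpoly_eq, eval_prod, ← card_univ, ← prod_const,
    ← prod_mul_distrib]
  refine prod_congr rfl fun i _ => ?_
  simp only [eval_sub, eval_X, eval_C, RCLike.ofReal_real_eq_id, id]
  field_simp
  ring

end Moments

/-! ### Effective resistance -/

section Resistance

open Classical Finset Matrix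

variable {V : Type*} [Fintype V]

lemma groundedLap_isSymm (G : SimpleGraph V) (v : V) : (groundedLap G v).IsSymm := by
  ext i j
  simp only [groundedLap, transpose_apply, of_apply, or_comm (a := j = v), eq_comm (a := j) (b := i),
    (G.isSymm_lapMatrix (R := ℝ)).apply]

lemma det_groundedLap (G : SimpleGraph V) (v : V) :
    (groundedLap G v).det = #(spanningTrees G).toFinset := by
  simpa using det_groundedLap_add G v 0

lemma card_spanningTrees_pos {G : SimpleGraph V} (hG : G.Connected) :
    0 < #(spanningTrees G).toFinset := by
  obtain ⟨T, hT⟩ := hG.exists_isTree_le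
  exact card_pos.2 ⟨T, Set.mem_toFinset.2 hT⟩

lemma isUnit_det_groundedLap {G : SimpleGraph V} (hG : G.Connected) (v : V) :
    IsUnit (groundedLap G v).det := by
  rw [det_groundedLap]
  exact (Nat.cast_ne_zero.2 (card_spanningTrees_pos hG).ne').isUnit

/-- The effective resistance between `v` and `u`. -/
noncomputable def resistance (G : SimpleGraph V) (v u : V) : ℝ :=
  (groundedLap G v)⁻¹ u u

lemma degree_moments {G : SimpleGraph V} (hG : G.Connected) (v : V) :
    ∑ T ∈ (spanningTrees G).toFinset, (deg v T : ℝ) =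
        #(spanningTrees G).toFinset * ∑ u ∈ G.neighborFinset v, resistance G v u ∧
      ∑ T ∈ (spanningTrees G).toFinset, (deg v T : ℝ) ^ 2 ≤
        #(spanningTrees G).toFinset * (∑ u ∈ G.neighborFinset v, resistance G v u) ^ 2 +
        #(spanningTrees G).toFinset * ∑ u ∈ G.neighborFinset v, resistance G v u := by
  set A := groundedLap G v with hA
  set D := neighborDiag G v with hD
  have hunit := isUnit_det_groundedLap hG v
  have hH : (D * A⁻¹ * D).IsHermitian := by
    have hD' : Dᴴ = D := by simp [hD, neighborDiag]
    have hA' : (A⁻¹)ᴴ = A⁻¹ := by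
      rw [conjTranspose_nonsing_inv, conjTranspose_eq_transpose_of_trivial, groundedLap_isSymm G v]
    rw [IsHermitian, conjTranspose_mul, conjTranspose_mul, hD', hA', mul_assoc]
  have hDD : D * D = D := by
    simp [hD, neighborDiag, diagonal_mul_diagonal]
  have hdet : ∀ s : ℝ, (A + s • D).det = A.det * (1 + s • (D * A⁻¹ * D)).det := by
    intro s
    -- Since `D` is idempotent, one copy can be moved across by `det (1 + MN) = det (1 + NM)`,
    -- making the perturbation symmetric.
    have : A + s • D = A * (1 + A⁻¹ * D * (s • D)) := by
      rw [mul_add, mul_one, ← mul_assoc, ← mul_assoc, mul_nonsing_inv _ hunit, one_mul,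
        Matrix.mul_smul, hDD]
    rw [this, det_mul, det_one_add_mul_comm, Matrix.smul_mul, mul_assoc]
  have htr : ∑ i, hH.eigenvalues i = ∑ u ∈ G.neighborFinset v, resistance G v u := by
    have h := hH.trace_eq_sum_eigenvalues
    simp only [RCLike.ofReal_real_eq_id, id] at h
    rw [← h, mul_assoc, trace_mul_comm, mul_assoc, hDD, trace]
    simp only [hD, neighborDiag, diag_apply, mul_diagonal, resistance, mul_ite, mul_one, mul_zero]
    rw [← sum_filter]
    congr 1
    ext u
    simp
  rw [← htr]
  refine moments_of_sum_pow_eq_prod _ _ _ _ (Nat.cast_nonneg _) fun s => ?_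
  rw [← det_groundedLap_add, hdet, det_groundedLap, det_one_add_smul_of_isHermitian hH]

lemma sum_degree_spanningTrees {G : SimpleGraph V} (T : SimpleGraph V) (hT : T ∈ spanningTrees G) :
    ∑ v, (deg v T : ℝ) = 2 * Fintype.card V - 2 := by
  have h1 := T.sum_degrees_eq_twice_card_edges
  have h2 := (mem_spanningTrees.1 hT).2.card_edgeFinset
  have h3 : ∑ v, deg v T + 2 = 2 * Fintype.card V := by
    simp only [deg]
    omega
  rw [eq_sub_iff_add_eq]
  exact_mod_cast h3

/-- Foster's theorem. -/
lemma sum_resistance {G : SimpleGraph V} (hG : G.Connected) :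
    ∑ v, ∑ u ∈ G.neighborFinset v, resistance G v u = 2 * Fintype.card V - 2 := by
  have hZ : (#(spanningTrees G).toFinset : ℝ) ≠ 0 :=
    Nat.cast_ne_zero.2 (card_spanningTrees_pos hG).ne'
  refine mul_left_cancel₀ hZ ?_
  -- Both sides count the total degree over all vertices and all spanning trees.
  rw [mul_sum, ← sum_congr rfl fun v _ => (degree_moments hG v).1, sum_comm,
    sum_congr rfl fun T hT => sum_degree_spanningTrees T (Set.mem_toFinset.1 hT), sum_const,
    nsmul_eq_mul]

lemma lapMatrix_dotProduct_comm (G : SimpleGraph V) (x y : V → ℝ) :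
    x ⬝ᵥ G.lapMatrix ℝ *ᵥ y = y ⬝ᵥ G.lapMatrix ℝ *ᵥ x := by
  rw [dotProduct_mulVec, ← mulVec_transpose, (G.isSymm_lapMatrix (R := ℝ)), dotProduct_comm]

lemma lapMatrix_energy_nonneg (G : SimpleGraph V) (x : V → ℝ) :
    0 ≤ x ⬝ᵥ G.lapMatrix ℝ *ᵥ x := by
  simpa using (G.posSemidef_lapMatrix ℝ).dotProduct_mulVec_nonneg x

lemma sq_sub_le_energy {G : SimpleGraph V} {u v : V} (huv : G.Adj u v) (x : V → ℝ) :
    (x u - x v) ^ 2 ≤ x ⬝ᵥ G.lapMatrix ℝ *ᵥ x := by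
  rw [← toLinearMap₂'_apply', G.lapMatrix_toLinearMap₂' ℝ]
  set F : V → V → ℝ := fun i j => if G.Adj i j then (x i - x j) ^ 2 else 0 with hF
  have hnn : ∀ i j, 0 ≤ F i j := fun i j => by
    simp only [hF]
    positivity
  have hrow : ∀ i j, F i j ≤ ∑ j, F i j := fun i j =>
    single_le_sum (fun j _ => hnn i j) (mem_univ j)
  have h2 : ∑ i ∈ {u, v}, ∑ j, F i j ≤ ∑ i, ∑ j, F i j :=
    sum_le_sum_of_subset_of_nonneg (subset_univ _) fun i _ _ => sum_nonneg fun j _ => hnn i j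
  rw [sum_pair huv.ne] at h2
  have hu := hrow u v
  have hv := hrow v u
  simp only [hF, huv, huv.symm, if_true] at hu hv h2 ⊢
  linarith [sub_sq_comm (x u) (x v)]

/-- The potential of the unit current from `u` to `v`. -/
lemma exists_potential {G : SimpleGraph V} (hG : G.Connected) {u v : V} (huv : u ≠ v) :
    ∃ φ : V → ℝ, φ v = 0 ∧ φ u = resistance G v u ∧
      ∀ x : V → ℝ, x v = 0 → x ⬝ᵥ G.lapMatrix ℝ *ᵥ φ = x u := by
  set φ := (groundedLap G v)⁻¹ *ᵥ Pi.single u 1 with hφ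
  have hA : groundedLap G v *ᵥ φ = Pi.single u 1 := by
    rw [hφ, mulVec_mulVec, mul_nonsing_inv _ (isUnit_det_groundedLap hG v), one_mulVec]
  have hv : φ v = 0 := by
    have h := congrFun hA v
    simpa [groundedLap, mulVec, dotProduct, huv.symm] using h
  refine ⟨φ, hv, by simp [hφ, resistance], fun x hx => ?_⟩
  -- Grounding altered row `v`, hence test functions vanishing at `v`; the altered column is
  -- harmless because `φ v = 0`.
  have hrow : ∀ i, i ≠ v → (G.lapMatrix ℝ *ᵥ φ) i = (Pi.single u 1 : V → ℝ) i := by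
    intro i hi
    rw [← hA]
    refine sum_congr rfl fun j _ => ?_
    by_cases hj : j = v
    · rw [hj, hv, mul_zero, mul_zero]
    · simp [groundedLap, hi, hj]
  have : x ⬝ᵥ G.lapMatrix ℝ *ᵥ φ = x ⬝ᵥ (Pi.single u 1 : V → ℝ) := by
    refine sum_congr rfl fun i _ => ?_
    by_cases hi : i = v
    · rw [hi, hx, zero_mul, zero_mul]
    · rw [hrow i hi]
  rw [this, dotProduct_single, mul_one]

/-- The potential has energy `R` and drop `R` across the edge, so `R² ≤ R`. -/
lemma resistance_le_one {G : SimpleGraph V} (hG : G.Connected) {u v : V} (huv : G.Adj u v) :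
    resistance G v u ≤ 1 := by
  obtain ⟨φ, hv, hu, h⟩ := exists_potential hG huv.ne
  have h1 := sq_sub_le_energy huv φ
  rw [h φ hv, hv, hu, sub_zero] at h1
  nlinarith

/-- Dirichlet's principle: the function equal to `1` at `u`, `0` at `v` and `1/2` elsewhere has
energy `(d + 1) / 2`, which bounds the conductance from above. -/
lemma le_resistance {G : SimpleGraph V} (hG : G.Connected) {d : ℕ} (hd : G.IsRegularOfDegree d)
    {u v : V} (huv : G.Adj u v) : 2 / ((d : ℝ) + 1) ≤ resistance G v u := by
  obtain ⟨φ, hv, hu, h⟩ := exists_potential hG huv.ne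
  set L := G.lapMatrix ℝ with hL
  set g : V → ℝ := Pi.single u 1 - Pi.single v 1 with hg
  set f : V → ℝ := (1 / 2 : ℝ) • ((fun _ => 1) + g) with hf
  have hfv : f v = 0 := by simp [hf, hg, huv.ne]
  have hfu : f u = 1 := by
    simp [hf, hg, huv.ne']
    norm_num
  have hL1 : L *ᵥ (fun _ => 1) = 0 := G.lapMatrix_mulVec_const_eq_zero
  have hgg : g ⬝ᵥ L *ᵥ g = 2 * (d + 1) := by
    simp only [hg, mulVec_sub, sub_dotProduct, single_dotProduct, mulVec_single_one, one_mul, hL,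
      Pi.sub_apply, col_apply, lapMatrix_apply, hd.degree_eq, huv, huv.symm, huv.ne, huv.ne',
      if_true, if_false, G.irrefl]
    ring
  have hff : f ⬝ᵥ L *ᵥ f = ((d : ℝ) + 1) / 2 := by
    have : L *ᵥ f = (1 / 2 : ℝ) • L *ᵥ g := by rw [hf, mulVec_smul, mulVec_add, hL1, zero_add]
    rw [this, dotProduct_smul, hL, lapMatrix_dotProduct_comm, ← hL, this, dotProduct_smul, hgg]
    simp only [smul_eq_mul]
    ring
  set Q : ℝ := ((d : ℝ) + 1) / 2 with hQ
  have hQ0 : 0 < Q := by positivity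
  clear_value f
  -- This energy expands to `Q² R - 2 Q + Q`, so `Q R ≥ 1`.
  have hpos := lapMatrix_energy_nonneg G (Q • φ - f)
  have hφf : φ ⬝ᵥ L *ᵥ f = 1 := by rw [hL, lapMatrix_dotProduct_comm, h f hfv, hfu]
  rw [← hL, mulVec_sub, mulVec_smul, dotProduct_sub, sub_dotProduct, sub_dotProduct, dotProduct_smul,
    dotProduct_smul, smul_dotProduct, smul_dotProduct, h φ hv, h f hfv, hfu, hff, hφf, hu] at hpos
  simp only [smul_eq_mul] at hpos
  rw [div_le_iff₀ (by positivity)]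
  have h1 : 0 ≤ Q * (Q * resistance G v u - 1) := by linarith
  have h2 := nonneg_of_mul_nonneg_right h1 hQ0
  rw [hQ] at h2
  linarith

theorem sum_sq_degree_le {G : SimpleGraph V} (hG : G.Connected) {d : ℕ}
    (hd : G.IsRegularOfDegree d) :
    ∑ v, ∑ T ∈ (spanningTrees G).toFinset, (deg v T : ℝ) ^ 2 ≤
      8 * (Fintype.card V * #(spanningTrees G).toFinset) := by
  set Z : ℝ := (#(spanningTrees G).toFinset : ℝ)
  set n : ℝ := (Fintype.card V : ℝ) with hn
  set ρ : V → ℝ := fun v => ∑ u ∈ G.neighborFinset v, resistance G v u with hρ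
  set c : ℝ := 2 / ((d : ℝ) + 1) with hc
  have hsum : ∑ v, ρ v = 2 * n - 2 := sum_resistance hG
  have hcard : ∀ v, #(G.neighborFinset v) = d := fun v => by
    rw [SimpleGraph.card_neighborFinset_eq_degree, hd.degree_eq]
  have hsq : ∀ v, ρ v ^ 2 ≤ d * ((1 + c) * ρ v - c * d) := by
    intro v
    calc ρ v ^ 2 ≤ #(G.neighborFinset v) * ∑ u ∈ G.neighborFinset v, resistance G v u ^ 2 :=
          sq_sum_le_card_mul_sum_sq
      _ ≤ d * ∑ u ∈ G.neighborFinset v, ((1 + c) * resistance G v u - c) := by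
          rw [hcard]
          gcongr with u hu
          have huv := ((G.mem_neighborFinset v u).1 hu).symm
          -- This is `(1 - R)(R - c) ≥ 0`.
          nlinarith [resistance_le_one hG huv, le_resistance hG hd huv]
      _ = d * ((1 + c) * ρ v - c * d) := by
          rw [sum_sub_distrib, ← mul_sum, sum_const, hcard, nsmul_eq_mul, mul_comm c]
  have hcd : c * (d + 1) = 2 := by
    rw [hc]
    field_simp
  have hc0 : 0 ≤ c := by positivity
  have hn0 : 0 ≤ n := by positivity
  have hd0 : (0 : ℝ) ≤ d := Nat.cast_nonneg d
  have hρ2 : ∑ v, ρ v ^ 2 ≤ 6 * n := by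
    calc ∑ v, ρ v ^ 2 ≤ ∑ v, d * ((1 + c) * ρ v - c * d) := sum_le_sum fun v _ => hsq v
      _ = d * ((1 + c) * (2 * n - 2) - n * (c * d)) := by
          rw [← mul_sum, sum_sub_distrib, ← mul_sum, hsum, sum_const, card_univ, nsmul_eq_mul]
      _ ≤ d * ((1 + c) * (2 * n) - n * (c * d)) := by
          gcongr
          linarith
      _ = n * (6 - 3 * c) := by linear_combination n * (3 - d) * hcd
      _ ≤ 6 * n := by nlinarith [mul_nonneg hn0 hc0]
  calc ∑ v, ∑ T ∈ (spanningTrees G).toFinset, (deg v T : ℝ) ^ 2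
      ≤ ∑ v, (Z * ρ v ^ 2 + Z * ρ v) := sum_le_sum fun v _ => (degree_moments hG v).2
    _ = Z * (∑ v, ρ v ^ 2 + ∑ v, ρ v) := by rw [sum_add_distrib, ← mul_sum, ← mul_sum, mul_add]
    _ ≤ Z * (6 * n + 2 * n) := by
        rw [hsum]
        gcongr
        linarith
    _ = 8 * (n * Z) := by ring

end Resistance

/-! ### Uniform averages as integrals -/

section Integral

open Finset

lemma integral_uniformOn {α : Type*} [Finite α] [MeasurableSpace α] [MeasurableSingletonClass α]
    (s : Finset α) (g : α → ℝ) :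
    ∫ a, g a ∂(uniformOn (s : Set α)) = (#s : ℝ)⁻¹ * ∑ a ∈ s, g a := by
  rw [uniformOn, ProbabilityTheory.cond, integral_smul_measure, setIntegral_finset _ (.of_finite s.finite_toSet),
    Measure.count_apply_finset]
  simp

end Integral

end SpanningTreeDegree

open SpanningTreeDegree in
theorem theorem1p2 :
    ∃ C : ℝ, 0 < C ∧ C ≤ 92 ∧
      ∀ (V : Type u) [Fintype V] [MeasurableSpace V] [DiscreteMeasurableSpace V]
        (G : SimpleGraph V) [DecidableRel G.Adj] (d : ℕ),
        G.Connected → G.IsRegularOfDegree d →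
        ∀ (Ω : Type v) [MeasurableSpace Ω] (P : Measure Ω) [IsProbabilityMeasure P]
          (ω : Ω → SimpleGraph V) (X : Ω → V),
          HasLaw ω (SpanningTreeDegree.ustMeasure G) P →
          HasLaw X (uniformOn (Set.univ : Set V)) P →
          IndepFun X ω P →
          Integrable (fun a => (SpanningTreeDegree.deg (X a) (ω a) : ℝ) ^ 2) P ∧
            ∫ a, (SpanningTreeDegree.deg (X a) (ω a) : ℝ) ^ 2 ∂P ≤ C := by
  classical
  refine ⟨8, by norm_num, by norm_num, ?_⟩
  intro V _ _ _ G _ d hG hd Ω _ P _ ω X hω hX hXω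
  have hP : IsProbabilityMeasure (ustMeasure G) := hω.isProbabilityMeasure_iff.1 inferInstance
  have hP' : IsProbabilityMeasure (uniformOn (Set.univ : Set V)) :=
    hX.isProbabilityMeasure_iff.1 inferInstance
  have hlaw := hXω.hasLaw_prod hX hω
  set F : V × SimpleGraph V → ℝ := fun p => (deg p.1 p.2 : ℝ) ^ 2 with hF
  have hint : Integrable F ((uniformOn (Set.univ : Set V)).prod (ustMeasure G)) := .of_finite
  refine ⟨?_, ?_⟩
  · have h := hint
    rw [← hlaw.map_eq] at h
    exact h.comp_aemeasurable hlaw.aemeasurable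
  · have h := hlaw.integral_comp hint.aestronglyMeasurable
    change ∫ a, (F ∘ fun a => (X a, ω a)) a ∂P ≤ 8
    rw [h, integral_prod _ hint, ← Finset.coe_univ, integral_uniformOn]
    have hust : ustMeasure G = uniformOn ((spanningTrees G).toFinset : Set (SimpleGraph V)) := by
      rw [Set.coe_toFinset, ustMeasure]
    simp only [hust, integral_uniformOn, hF]
    have hmain := sum_sq_degree_le hG (d := d) fun v => by convert hd v
    have hn : (0 : ℝ) < Fintype.card V := by
      have := hG.nonempty
      exact_mod_cast Fintype.card_pos
    have hZ : (0 : ℝ) < (spanningTrees G).toFinset.card := by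
      exact_mod_cast card_spanningTrees_pos hG
    rw [← Finset.mul_sum, Finset.card_univ, ← mul_assoc, ← mul_inv,
      inv_mul_le_iff₀ (by positivity), mul_comm _ (8 : ℝ)]
    convert hmain
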